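/- Let $K$ be a field, $X$ a set of generators, each $x\in X$ with a degree $|x|\ge 1$, such that only finitely many generators have any given degree (for instance $X$ finite and all $|x|=1$). The degree of a word is the sum of the degrees of its letters. Let $A=K\langle X\mid R\rangle$ be the quotient of the free associative algebra by the two-sided ideal $I$ generated by $R$. Assume $A\neq 0$ and that $A$ is graded by degree, i.e. $A=\bigoplus_{d\ge 0}A_d$, where $A_d$ is the span of the classes of the words of degree $d$ (as is the case when the relations $R$ are homogeneous). Fix an admissible ordering of words, i.e. a total well-ordering compatible with left and right multiplication. Let $G$ be a reduced Gröbner basis of $I$: the leading word of every nonzero element of $I$ contains the leading word of an element of $G$ as a subword; every $g\in G$ has leading coefficient $1$; all other words of $g$ contain no leading word of an element of $G$; and no leading word of an element of $G$ contains the leading word of another element of $G$. Let $F$ be the set of leading words of $G$. A word is normal if it contains no element of $F$ as a subword. Define $n$-chains and their tails, for $n\ge -1$: the only $(-1)$-chain is the empty word, which is its own tail; the $0$-chains are the elements of $X$, which are their own tails; and for $n\ge 1$ an $n$-chain with tail $t$ is a word $gt$ where $g$ is an $(n-1)$-chain with some tail $r$, $t$ is a normal word, and $rt$ contains exactly one occurrence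 of an element of $F$ as a subword, this occurrence being at the end of $rt$. Let $C_n\subset K\langle X\rangle$ be the span of the $n$-chains. For a graded space $V$ write $H_V=\sum_d \dim(V_d)\,t^d\in\mathbb Z[[t]]$, and write $H_X$, $H_F$ for the generating functions by degree of the sets of words $X$, $F$. Then all $A_d$ and $(C_n)_d$ are finite-dimensional, $$H_{C_{-1}}=1,\qquad H_{C_0}=H_X,\qquad H_{C_1}=H_F,$$ the sum $H_{C_{-1}}-H_{C_0}+H_{C_1}-H_{C_2}+\cdots$ converges in $\mathbb Z[[t]]$ (in each degree only finitely many terms are nonzero), and $$H_A=\left(H_{C_{-1}}-H_{C_0}+H_{C_1}-H_{C_2}+\cdots\right)^{-1}.$$ -/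

import Mathlib

open scoped PowerSeries.WithPiTopology

noncomputable section

namespace HilbertChains

universe u v

/-- The free associative algebra `K⟨X⟩`: finite `K`-linear combinations of words in `X`. -/
abbrev FreeAlg (K : Type u) (X : Type v) [Field K] := MonoidAlgebra K (FreeMonoid X)

/-- A word, viewed as an element of the free algebra. -/
def wordElt (K : Type u) {X : Type v} [Field K] (m : FreeMonoid X) : FreeAlg K X :=
  MonoidAlgebra.single m 1

/-- The algebra `K⟨X | R⟩`: the free algebra modulo the two-sided ideal generated by `R`. -/
abbrev PresentedAlg {K : Type u} {X : Type v} [Field K] (R : Set (FreeAlg K X)) :=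
  (TwoSidedIdeal.span R).ringCon.Quotient

/-! ### Words, admissible orderings, Gröbner bases -/

/-- `f` occurs in `m` as a (contiguous) subword. -/
def IsSubword {X : Type v} (f m : FreeMonoid X) : Prop :=
  ∃ a b : FreeMonoid X, m = a * f * b

/-- A word is normal with respect to `F` if it contains no element of `F` as a subword. -/
def IsNormal {X : Type v} (F : Set (FreeMonoid X)) (m : FreeMonoid X) : Prop :=
  ∀ f ∈ F, ¬ IsSubword f m

/-- An admissible ordering of words: a total well-ordering that is compatible with
multiplication on both sides. -/
structure IsAdmissible {X : Type v} (lt : FreeMonoid X → FreeMonoid X → Prop) : Prop where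
  isWellOrder : IsWellOrder (FreeMonoid X) lt
  mul_left : ∀ a b c : FreeMonoid X, lt a b → lt (c * a) (c * b)
  mul_right : ∀ a b c : FreeMonoid X, lt a b → lt (a * c) (b * c)

/-- `m` is the leading word of `f` (so in particular `f ≠ 0`). -/
def IsLeadingWord {K : Type u} {X : Type v} [Field K] (lt : FreeMonoid X → FreeMonoid X → Prop)
    (f : FreeAlg K X) (m : FreeMonoid X) : Prop :=
  m ∈ f.coeff.support ∧ ∀ m' ∈ f.coeff.support, m' ≠ m → lt m' m

/-- The set of leading words of the elements of `G` (the obstructions, if `G` is the reduced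
Gröbner basis). -/
def leadingWords {K : Type u} {X : Type v} [Field K] (lt : FreeMonoid X → FreeMonoid X → Prop)
    (G : Set (FreeAlg K X)) : Set (FreeMonoid X) :=
  {m | ∃ g ∈ G, IsLeadingWord lt g m}

/-- `G` is a Gröbner basis of the two-sided ideal `I`. -/
structure IsGroebnerBasis {K : Type u} {X : Type v} [Field K]
    (lt : FreeMonoid X → FreeMonoid X → Prop) (I : TwoSidedIdeal (FreeAlg K X))
    (G : Set (FreeAlg K X)) : Prop where
  subset : ∀ g ∈ G, g ∈ I
  divides : ∀ f ∈ I, ∀ m, IsLeadingWord lt f m → ∃ m' ∈ leadingWords lt G, IsSubword m' m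

/-- `G` is a reduced Gröbner basis of `I`: its elements are monic, their non-leading words are
normal, and no leading word contains the leading word of another element. -/
structure IsReducedGroebnerBasis {K : Type u} {X : Type v} [Field K]
    (lt : FreeMonoid X → FreeMonoid X → Prop) (I : TwoSidedIdeal (FreeAlg K X))
    (G : Set (FreeAlg K X)) : Prop extends IsGroebnerBasis lt I G where
  monic : ∀ g ∈ G, ∃ m, IsLeadingWord lt g m ∧ g.coeff m = 1
  tail_normal : ∀ g ∈ G, ∀ m, IsLeadingWord lt g m →
    ∀ m' ∈ g.coeff.support, m' ≠ m → IsNormal (leadingWords lt G) m'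
  minimal : ∀ g ∈ G, ∀ g' ∈ G, g ≠ g' → ∀ m m', IsLeadingWord lt g m →
    IsLeadingWord lt g' m' → ¬ IsSubword m m'

/-! ### Chains -/

/-- `deg_F m`: the number of occurrences of elements of `F` in `m` as subwords. -/
def degF {X : Type v} (F : Set (FreeMonoid X)) (m : FreeMonoid X) : ℕ∞ :=
  Set.encard {p : FreeMonoid X × FreeMonoid X × FreeMonoid X |
    p.2.1 ∈ F ∧ p.1 * p.2.1 * p.2.2 = m}

/-- `IsChain F k c t`: the word `c` is a `(k - 1)`-chain over `F` with tail `t`. The index is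
shifted by one, so that `k = 0, 1, 2, …` stands for `(-1)`-chains, `0`-chains, `1`-chains, … -/
inductive IsChain {X : Type v} (F : Set (FreeMonoid X)) :
    ℕ → FreeMonoid X → FreeMonoid X → Prop
  | empty : IsChain F 0 1 1
  | letter (x : X) : IsChain F 1 (FreeMonoid.of x) (FreeMonoid.of x)
  | extend {k : ℕ} {g r t : FreeMonoid X} (hg : IsChain F (k + 1) g r) (ht : IsNormal F t)
      (hdeg : degF F (r * t) = 1) (hend : ∃ f ∈ F, ∃ a, r * t = a * f) :
      IsChain F (k + 2) (g * t) t

/-- `C_{k-1}`: the span of the `(k - 1)`-chains in the free algebra. -/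
def chainSpan (K : Type u) {X : Type v} [Field K] (F : Set (FreeMonoid X)) (k : ℕ) :
    Submodule K (FreeAlg K X) :=
  Submodule.span K (wordElt K '' {c | ∃ t, IsChain F k c t})

/-! ### Gradings and Hilbert series -/

/-- The weight (degree) of a word, for generators `x` of degree `wt x`. -/
def weight {X : Type v} (wt : X → ℕ) (m : FreeMonoid X) : ℕ :=
  (m.toList.map wt).sum

/-- The degree `d` component of the free algebra. -/
def freeComponent (K : Type u) {X : Type v} [Field K] (wt : X → ℕ) (d : ℕ) :
    Submodule K (FreeAlg K X) :=
  Submodule.span K (wordElt K '' {m | weight wt m = d})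

/-- The degree `d` component of `K⟨X | R⟩`: the span of the classes of the words of degree `d`. -/
def algComponent {K : Type u} {X : Type v} [Field K] (wt : X → ℕ) (R : Set (FreeAlg K X))
    (d : ℕ) : Submodule K (PresentedAlg R) :=
  (freeComponent K wt d).map ((TwoSidedIdeal.span R).ringCon.mkₐ (α := K)).toLinearMap

/-- The degree `d` component of `C_{k-1}`. -/
def chainComponent (K : Type u) {X : Type v} [Field K] (wt : X → ℕ) (F : Set (FreeMonoid X))
    (k d : ℕ) : Submodule K (FreeAlg K X) :=
  chainSpan K F k ⊓ freeComponent K wt d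

/-- The Hilbert series `∑ d, dim (V d) t ^ d` of a family of homogeneous components. -/
def hilbertSeries {K : Type u} {V : Type*} [Field K] [AddCommGroup V] [Module K V]
    (𝒱 : ℕ → Submodule K V) : PowerSeries ℤ :=
  PowerSeries.mk fun d => (Module.finrank K (𝒱 d) : ℤ)

/-- The generating function of a set `S` of words, counted by degree. -/
def wordSeries {X : Type v} (wt : X → ℕ) (S : Set (FreeMonoid X)) : PowerSeries ℤ :=
  PowerSeries.mk fun d => (Set.ncard {m ∈ S | weight wt m = d} : ℤ)

end HilbertChains

end

/-! Normal words form a basis of `A`: rewriting by `G` expresses every word through smaller ones,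
and a nonzero combination of normal words cannot lie in `I`. Since `A` is graded, this holds degree
by degree, so `H_A` counts normal words, and the theorem becomes an identity about words: the series
of normal words times the alternating sum of the chain series is 1.

The identity is a telescoping bijection. Take a pair of a chain `c` with tail `t` and a normal word
`s`. If `t * s` is not normal, let `t * s₁` be its shortest non-normal prefix, with `s = s₁ * s₂`.
Then `c * s₁` is a chain of the next order with tail `s₁`, and `s₁ * s₂` is normal. Conversely, any
pair whose tail and normal word have normal product arises this way, by giving the tail back to the
word. So the bad pairs of one order match the good pairs of the next (`pairSeries_infusiblePairs`)
and cancel in the alternating sum. What survives is 1, from the pair of empty words, and an error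
term involving only long chains; long chains have large degree, so the error disappears in the
limit.

The bijection is well defined because "exactly one obstruction, at the end" means "non-normal with
normal proper prefixes" when `F` is an antichain (`isMinimalNonnormal_of_degF`,
`IsMinimalNonnormal.degF_eq_one`), and a word has at most one such prefix. Hence chains of a given
order form a prefix code with unique tails (`IsChain.eq_of_mul_eq_mul`). -/

namespace HilbertChains

universe u v

variable {X : Type v}

/-! ### Words -/

/-- Two factorizations of the same word are comparable. -/
theorem mul_eq_mul_cases {a b c d : FreeMonoid X} (h : a * b = c * d) :
    (∃ e, c = a * e ∧ b = e * d) ∨ ∃ e, a = c * e ∧ d = e * b :=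
  List.append_eq_append_iff.1 (congrArg FreeMonoid.toList h)

theorem weight_one (wt : X → ℕ) : weight wt 1 = 0 := rfl

theorem weight_mul (wt : X → ℕ) (a b : FreeMonoid X) :
    weight wt (a * b) = weight wt a + weight wt b := by
  simp [weight]

theorem weight_of (wt : X → ℕ) (x : X) : weight wt (FreeMonoid.of x) = wt x := by
  simp [weight]

theorem length_le_weight {wt : X → ℕ} (hwt : ∀ x, 0 < wt x) (m : FreeMonoid X) :
    m.length ≤ weight wt m := by
  induction m using FreeMonoid.inductionOn' with
  | one => simp
  | of_mul x m ih =>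
    rw [FreeMonoid.length_mul, weight_mul, weight_of, FreeMonoid.length_of]
    have := hwt x
    omega

theorem finite_setOf_weight_le {wt : X → ℕ} (hpos : ∀ x, 0 < wt x)
    (hfin : ∀ d, {x | wt x = d}.Finite) (d : ℕ) : {m | weight wt m ≤ d}.Finite := by
  induction d with
  | zero =>
    refine (Set.finite_singleton (1 : FreeMonoid X)).subset fun m hm => ?_
    have := (length_le_weight hpos m).trans hm
    exact FreeMonoid.length_eq_zero.1 (Nat.le_zero.1 this)
  | succ d ih =>
    have hX : {x | wt x ≤ d + 1}.Finite := by
      refine ((Set.finite_Iic (d + 1)).biUnion fun i _ => hfin i).subset fun x hx => ?_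
      simpa using hx
    refine ((Set.finite_singleton 1).union
      (hX.image2 (fun x m => FreeMonoid.of x * m) ih)).subset fun m hm => ?_
    induction m using FreeMonoid.inductionOn' with
    | one => exact Or.inl rfl
    | of_mul x m _ =>
      rw [Set.mem_ofPred_eq, weight_mul, weight_of] at hm
      have := hpos x
      exact Or.inr ⟨x, by simp; omega, m, by simp; omega, rfl⟩

theorem finite_setOf_weight_eq {wt : X → ℕ} (hpos : ∀ x, 0 < wt x)
    (hfin : ∀ d, {x | wt x = d}.Finite) (d : ℕ) : {m | weight wt m = d}.Finite :=
  (finite_setOf_weight_le hpos hfin d).subset fun _ hm => hm.le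

/-! ### Minimal non-normal words -/

section Obstructions

variable {F : Set (FreeMonoid X)}

theorem IsNormal.of_isSubword {m m' : FreeMonoid X} (h : IsNormal F m) (hm : IsSubword m' m) :
    IsNormal F m' := by
  rintro f hf ⟨a, b, rfl⟩
  obtain ⟨c, d, rfl⟩ := hm
  exact h f hf ⟨c * a, b * d, by simp only [mul_assoc]⟩

theorem IsNormal.left {a b : FreeMonoid X} (h : IsNormal F (a * b)) : IsNormal F a :=
  h.of_isSubword ⟨1, b, by simp⟩

theorem IsNormal.right {a b : FreeMonoid X} (h : IsNormal F (a * b)) : IsNormal F b :=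
  h.of_isSubword ⟨a, 1, by simp⟩

/-- All proper prefixes of `m` are normal. -/
def HasNormalPrefixes (F : Set (FreeMonoid X)) (m : FreeMonoid X) : Prop :=
  ∀ p q, m = p * q → q ≠ 1 → IsNormal F p

theorem IsNormal.hasNormalPrefixes {m : FreeMonoid X} (h : IsNormal F m) :
    HasNormalPrefixes F m := by
  rintro p q rfl -
  exact h.left

/-- `m` is not normal, but all its proper prefixes are. -/
def IsMinimalNonnormal (F : Set (FreeMonoid X)) (m : FreeMonoid X) : Prop :=
  ¬ IsNormal F m ∧ HasNormalPrefixes F m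

/-- Two prefixes of one word are comparable, and the shorter, being non-normal, cannot be a proper
prefix of the longer. -/
theorem IsMinimalNonnormal.eq_of_mul_eq_mul {a b c d : FreeMonoid X}
    (ha : IsMinimalNonnormal F a) (hc : IsMinimalNonnormal F c) (h : a * b = c * d) : a = c := by
  rcases mul_eq_mul_cases h with ⟨e, he, -⟩ | ⟨e, he, -⟩
  · by_cases h1 : e = 1
    · simpa [h1] using he.symm
    · exact absurd (hc.2 _ _ he h1) ha.1
  · by_cases h1 : e = 1
    · simpa [h1] using he
    · exact absurd (ha.2 _ _ he h1) hc.1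

theorem exists_prefix_isMinimalNonnormal (m : FreeMonoid X) (hm : ¬ IsNormal F m) :
    ∃ p q, m = p * q ∧ IsMinimalNonnormal F p := by
  by_cases h : HasNormalPrefixes F m
  · exact ⟨m, 1, by simp, hm, h⟩
  · simp only [HasNormalPrefixes, not_forall] at h
    obtain ⟨p, q, hpq, hq, hp⟩ := h
    have hlt : p.length < m.length := by
      have : q.length ≠ 0 := fun h0 => hq (FreeMonoid.length_eq_zero.1 h0)
      rw [hpq, FreeMonoid.length_mul]
      omega
    obtain ⟨p', q', h', hmin⟩ := exists_prefix_isMinimalNonnormal p hp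
    exact ⟨p', q' * q, by rw [hpq, h', mul_assoc], hmin⟩
termination_by m.length

theorem exists_split_of_not_isNormal_mul {t s : FreeMonoid X} (ht : HasNormalPrefixes F t)
    (h : ¬ IsNormal F (t * s)) : ∃ s₁ s₂, s = s₁ * s₂ ∧ IsMinimalNonnormal F (t * s₁) := by
  obtain ⟨p, q, hpq, hp⟩ := exists_prefix_isMinimalNonnormal _ h
  rcases mul_eq_mul_cases hpq with ⟨e, rfl, he⟩ | ⟨e, he, he'⟩
  · exact ⟨e, q, he, hp⟩
  -- Here `t` may itself be non-normal, in which case nothing is taken from `s`. For tails of chains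
  -- this happens only when `t` is a letter lying in `F`.
  · by_cases h1 : e = 1
    · subst h1
      refine ⟨1, s, by simp, ?_⟩
      simpa [he] using hp
    · exact absurd (ht _ _ he h1) hp.1

/-- An obstruction inside a proper prefix would be a second occurrence, distinct from the one at the
end. -/
theorem isMinimalNonnormal_of_degF {m : FreeMonoid X} (hdeg : degF F m = 1)
    (hend : ∃ f ∈ F, ∃ a, m = a * f) : IsMinimalNonnormal F m := by
  obtain ⟨f, hf, a, rfl⟩ := hend
  refine ⟨fun h => h f hf ⟨a, 1, by simp⟩, ?_⟩
  rintro p q hpq hq f' hf' ⟨c, d, rfl⟩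
  obtain ⟨x, hx⟩ := Set.encard_eq_one.1 hdeg
  have h1 : (a, f, (1 : FreeMonoid X)) = x := by
    rw [← Set.mem_singleton_iff, ← hx]
    exact ⟨hf, by simp⟩
  have h2 : (c, f', d * q) = x := by
    rw [← Set.mem_singleton_iff, ← hx]
    exact ⟨hf', by rw [hpq]; simp only [mul_assoc]⟩
  have h3 : d * q = 1 := by
    have := h2.trans h1.symm
    simp only [Prod.mk.injEq] at this
    exact this.2.2
  have := congrArg FreeMonoid.length h3
  rw [FreeMonoid.length_mul, FreeMonoid.length_one] at this
  exact hq (FreeMonoid.length_eq_zero.1 (by omega))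

theorem IsMinimalNonnormal.exists_end {m : FreeMonoid X} (hm : IsMinimalNonnormal F m)
    {f a b : FreeMonoid X} (hf : f ∈ F) (h : m = a * f * b) : b = 1 := by
  by_contra hb
  exact hm.2 _ _ h hb f hf ⟨a, 1, by simp⟩

/-- A minimal non-normal word over an antichain contains exactly one obstruction, at its end. -/
theorem IsMinimalNonnormal.degF_eq_one
    (hanti : ∀ f ∈ F, ∀ f' ∈ F, IsSubword f f' → f = f') {m : FreeMonoid X}
    (hm : IsMinimalNonnormal F m) : degF F m = 1 ∧ ∃ f ∈ F, ∃ a, m = a * f := by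
  have h := hm.1
  simp only [IsNormal, not_forall, not_not] at h
  obtain ⟨f, hf, a, b, hmab⟩ := h
  obtain rfl := hm.exists_end hf hmab
  rw [mul_one] at hmab
  refine ⟨Set.encard_eq_one.2 ⟨(a, f, 1), ?_⟩, f, hf, a, hmab⟩
  ext ⟨c, f', d⟩
  simp only [Set.mem_ofPred_eq, Set.mem_singleton_iff, Prod.mk.injEq]
  constructor
  · rintro ⟨hf', h'⟩
    obtain rfl := hm.exists_end hf' h'.symm
    rw [mul_one, hmab] at h'
    have hff : f' = f := by
      rcases mul_eq_mul_cases h' with ⟨e, -, he⟩ | ⟨e, -, he⟩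
      · exact (hanti f hf f' hf' ⟨e, 1, by simpa using he⟩).symm
      · exact hanti f' hf' f hf ⟨e, 1, by simpa using he⟩
    subst hff
    exact ⟨mul_right_cancel h', rfl, rfl⟩
  · rintro ⟨rfl, rfl, rfl⟩
    exact ⟨hf, by simp [hmab]⟩

/-! ### Chains -/

/-- Normality of the tail itself would be too much to ask: a generator may belong to `F`, and it is
still a 0-chain. -/
theorem IsChain.hasNormalPrefixes (h1 : IsNormal F 1) {k : ℕ} {c t : FreeMonoid X}
    (h : IsChain F k c t) : HasNormalPrefixes F t := by
  cases h with
  | empty => exact h1.hasNormalPrefixes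
  | letter x =>
    intro p q hpq hq
    have := congrArg FreeMonoid.length hpq
    rw [FreeMonoid.length_mul, FreeMonoid.length_of] at this
    have hq' : q.length ≠ 0 := fun h0 => hq (FreeMonoid.length_eq_zero.1 h0)
    rwa [FreeMonoid.length_eq_zero.1 (show p.length = 0 by omega)]
  | extend _ ht _ _ => exact ht.hasNormalPrefixes

/-- Chains of the same order form a prefix code, and their tails are unique. -/
theorem IsChain.eq_of_mul_eq_mul {k : ℕ} {c t c' t' u u' : FreeMonoid X} (h : IsChain F k c t)
    (h' : IsChain F k c' t') (hu : c * u = c' * u') : c = c' ∧ t = t' := by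
  induction h generalizing c' t' u u' with
  | empty => cases h'; exact ⟨rfl, rfl⟩
  | letter x =>
    cases h' with
    | letter y =>
      have : x = y := (List.cons.inj (congrArg FreeMonoid.toList hu)).1
      simp [this]
  | @extend k g r t hg ht hdeg hend ih =>
    cases h' with
    | @extend _ g' r' _ hg' ht' hdeg' hend' =>
      rw [mul_assoc, mul_assoc] at hu
      obtain ⟨rfl, rfl⟩ := ih hg' hu
      have hu' := mul_left_cancel hu
      -- Once the shorter chains and their tails `r` agree, `r * t` and the other candidate are
      -- minimal non-normal prefixes of the same word.
      have := (isMinimalNonnormal_of_degF hdeg hend).eq_of_mul_eq_mul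
        (isMinimalNonnormal_of_degF hdeg' hend') (b := u) (d := u')
        (by rw [mul_assoc, hu', mul_assoc])
      obtain rfl := mul_left_cancel this
      exact ⟨rfl, rfl⟩

theorem IsChain.isMinimalNonnormal_of_extend {k : ℕ} {c t : FreeMonoid X}
    (h : IsChain F (k + 2) c t) : ∃ g r, IsChain F (k + 1) g r ∧ IsNormal F t ∧
      IsMinimalNonnormal F (r * t) ∧ c = g * t := by
  cases h with
  | extend hg ht hdeg hend => exact ⟨_, _, hg, ht, isMinimalNonnormal_of_degF hdeg hend, rfl⟩

/-- Each extension adds at least one letter, unless the new tail is empty. An empty tail cannot be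
extended further, since `1 * t` would be both normal and non-normal; so at most one unit is lost,
and the second clause carries the induction. -/
theorem IsChain.le_length {k : ℕ} {c t : FreeMonoid X} (h : IsChain F k c t) :
    k ≤ c.length + 1 ∧ (t ≠ 1 → k ≤ c.length) := by
  induction h with
  | empty => simp
  | letter x => simp
  | @extend k g r t hg ht hdeg hend ih =>
    have hr : r ≠ 1 := by
      rintro rfl
      rw [one_mul] at hdeg hend
      exact (isMinimalNonnormal_of_degF hdeg hend).1 ht
    have := ih.2 hr
    rw [FreeMonoid.length_mul]
    refine ⟨by omega, fun h1 => ?_⟩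
    have ht' : t.length ≠ 0 := fun h0 => h1 (FreeMonoid.length_eq_zero.1 h0)
    omega

theorem isChain_zero_iff {c : FreeMonoid X} : (∃ t, IsChain F 0 c t) ↔ c = 1 :=
  ⟨fun ⟨_, h⟩ => by cases h; rfl, by rintro rfl; exact ⟨1, .empty⟩⟩

theorem isChain_one_iff {c : FreeMonoid X} :
    (∃ t, IsChain F 1 c t) ↔ c ∈ Set.range FreeMonoid.of :=
  ⟨fun ⟨_, h⟩ => by cases h with | letter x => exact ⟨x, rfl⟩, by rintro ⟨x, rfl⟩; exact ⟨_, .letter x⟩⟩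

/-- For a letter `x` and a normal `t`, an obstruction in `x * t` must start at `x`; minimality makes
it end with `t`, so it is the whole word. Conversely, by the antichain property a word of `F`
contains no obstruction but itself. -/
theorem isChain_two_iff (h1 : IsNormal F 1)
    (hanti : ∀ f ∈ F, ∀ f' ∈ F, IsSubword f f' → f = f') {c : FreeMonoid X} :
    (∃ t, IsChain F 2 c t) ↔ c ∈ F := by
  constructor
  · rintro ⟨t, h⟩
    obtain ⟨g, r, hg, ht, hmin, rfl⟩ := h.isMinimalNonnormal_of_extend
    cases hg with
    | letter x =>
      have h := hmin.1
      simp only [IsNormal, not_forall, not_not] at h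
      obtain ⟨f, hf, a, b, hab⟩ := h
      obtain rfl := hmin.exists_end hf hab
      rw [mul_one] at hab
      induction a using FreeMonoid.inductionOn' with
      | one => rwa [hab, one_mul]
      | of_mul y a _ =>
        rw [mul_assoc] at hab
        have : t = a * f := (List.cons.inj (congrArg FreeMonoid.toList hab)).2
        exact absurd ⟨a, 1, by simpa using this⟩ (ht f hf)
  · intro hc
    induction c using FreeMonoid.inductionOn' with
    | one => exact absurd ⟨1, 1, by simp⟩ (h1 1 hc)
    | of_mul x t _ =>
      have hsub : ∀ f ∈ F, ∀ a b, FreeMonoid.of x * t = a * f * b → a = 1 ∧ b = 1 := by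
        intro f hf a b hab
        have h2 := congrArg FreeMonoid.length hab
        rw [hanti f hf _ hc ⟨a, b, hab⟩, FreeMonoid.length_mul _ b,
          FreeMonoid.length_mul a] at h2
        exact ⟨FreeMonoid.length_eq_zero.1 (by omega), FreeMonoid.length_eq_zero.1 (by omega)⟩
      have hmin : IsMinimalNonnormal F (FreeMonoid.of x * t) := by
        refine ⟨fun h => h _ hc ⟨1, 1, by simp⟩, ?_⟩
        rintro p q hpq hq f hf ⟨a, b, rfl⟩
        have h2 := congrArg FreeMonoid.length (hsub f hf a (b * q) (by
          rw [hpq]; simp only [mul_assoc])).2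
        rw [FreeMonoid.length_mul, FreeMonoid.length_one] at h2
        exact hq (FreeMonoid.length_eq_zero.1 (by omega))
      have ht : IsNormal F t := by
        rintro f hf ⟨a, b, hab⟩
        have h2 := congrArg FreeMonoid.length (hsub f hf (FreeMonoid.of x * a) b (by
          rw [hab]; simp only [mul_assoc])).1
        rw [FreeMonoid.length_mul, FreeMonoid.length_one, FreeMonoid.length_of] at h2
        omega
      exact ⟨t, .extend (.letter x) ht (hmin.degF_eq_one hanti).1 (hmin.degF_eq_one hanti).2⟩

end Obstructions

/-! ### Counting chains followed by a normal word -/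

/-- The generating function of a set of pairs of words, counted by total degree. -/
noncomputable def pairSeries (wt : X → ℕ) (S : Set (FreeMonoid X × FreeMonoid X)) :
    PowerSeries ℤ :=
  PowerSeries.mk fun d => (Set.ncard {p ∈ S | weight wt p.1 + weight wt p.2 = d} : ℤ)

section PairSeries

variable {wt : X → ℕ}

theorem finite_setOf_pair_weight_eq (hfin : ∀ d, {m | weight wt m = d}.Finite) (d : ℕ) :
    {p : FreeMonoid X × FreeMonoid X | weight wt p.1 + weight wt p.2 = d}.Finite := by
  refine ((Finset.HasAntidiagonal.antidiagonal d).finite_toSet.biUnion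
    fun ij _ => (hfin ij.1).prod (hfin ij.2)).subset fun p hp => ?_
  simp only [Set.mem_iUnion]
  exact ⟨(weight wt p.1, weight wt p.2), by simpa using hp, rfl, rfl⟩

theorem wordSeries_mul_wordSeries (hfin : ∀ d, {m | weight wt m = d}.Finite)
    (S T : Set (FreeMonoid X)) :
    wordSeries wt S * wordSeries wt T = pairSeries wt (S ×ˢ T) := by
  classical
  ext d
  have hP : {p ∈ S ×ˢ T | weight wt p.1 + weight wt p.2 = d}.Finite :=
    (finite_setOf_pair_weight_eq hfin d).subset fun _ h => h.2
  simp only [PowerSeries.coeff_mul, wordSeries, pairSeries, PowerSeries.coeff_mk]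
  rw [Set.ncard_eq_toFinset_card _ hP, Finset.card_eq_sum_card_fiberwise
    (f := fun p => (weight wt p.1, weight wt p.2)) (t := Finset.HasAntidiagonal.antidiagonal d)]
  · rw [Nat.cast_sum]
    refine Finset.sum_congr rfl fun ij hij => ?_
    rw [← Nat.cast_mul, ← Set.ncard_prod, Nat.cast_inj, ← Set.ncard_coe_finset]
    congr 1
    ext p
    rw [Finset.HasAntidiagonal.mem_antidiagonal] at hij
    simp only [Set.mem_prod, Finset.coe_filter, Set.Finite.mem_toFinset, Set.mem_ofPred_eq,
      Prod.ext_iff]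
    constructor
    · rintro ⟨⟨h1, h2⟩, h3, h4⟩
      exact ⟨⟨⟨h1, h3⟩, by omega⟩, h2, h4⟩
    · rintro ⟨⟨⟨h1, h3⟩, -⟩, h2, h4⟩
      exact ⟨⟨h1, h2⟩, h3, h4⟩
  · intro p hp
    simp only [Finset.mem_coe, Set.Finite.mem_toFinset] at hp
    simpa using hp.2

theorem pairSeries_union (hfin : ∀ d, {m | weight wt m = d}.Finite)
    {S T : Set (FreeMonoid X × FreeMonoid X)} (h : Disjoint S T) :
    pairSeries wt (S ∪ T) = pairSeries wt S + pairSeries wt T := by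
  have hP : ∀ (S : Set (FreeMonoid X × FreeMonoid X)) d,
    {p ∈ S | weight wt p.1 + weight wt p.2 = d}.Finite := fun S d =>
      (finite_setOf_pair_weight_eq hfin d).subset fun _ h => h.2
  ext d
  simp only [pairSeries, map_add, PowerSeries.coeff_mk]
  rw [← Nat.cast_add, ← Set.ncard_union_eq _ (hP S d) (hP T d)]
  · congr 2
    ext p
    simp only [Set.mem_union, Set.mem_ofPred_eq, or_and_right]
  · exact h.mono (fun _ h => h.1) fun _ h => h.1

theorem pairSeries_singleton_one : pairSeries wt {((1 : FreeMonoid X), (1 : FreeMonoid X))} = 1 := by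
  ext d
  rw [pairSeries, PowerSeries.coeff_mk, PowerSeries.coeff_one]
  split_ifs with hd
  · rw [Nat.cast_eq_one, Set.ncard_eq_one]
    refine ⟨(1, 1), ?_⟩
    ext p
    simp only [Set.mem_ofPred_eq, Set.mem_singleton_iff, and_iff_left_iff_imp]
    rintro rfl
    simp [weight_one, hd]
  · rw [Nat.cast_eq_zero]
    convert Set.ncard_empty (FreeMonoid X × FreeMonoid X)
    refine Set.eq_empty_of_forall_notMem ?_
    rintro p ⟨hp, h⟩
    rw [Set.mem_singleton_iff] at hp
    rw [hp] at h
    simp only [weight_one] at h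
    omega

/-- A degree-preserving one-to-one correspondence preserves generating functions. -/
theorem pairSeries_congr {S T : Set (FreeMonoid X × FreeMonoid X)}
    (r : FreeMonoid X × FreeMonoid X → FreeMonoid X × FreeMonoid X → Prop)
    (hr : ∀ p q, r p q → weight wt p.1 + weight wt p.2 = weight wt q.1 + weight wt q.2)
    (hST : ∀ p ∈ S, ∃ q ∈ T, r p q) (hTS : ∀ q ∈ T, ∃ p ∈ S, r p q)
    (hinj : ∀ p p' q, r p q → r p' q → p = p') (hfun : ∀ p q q', r p q → r p q' → q = q') :
    pairSeries wt S = pairSeries wt T := by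
  choose f hfT hf using hST
  ext d
  simp only [pairSeries, PowerSeries.coeff_mk, Nat.cast_inj]
  refine Set.ncard_congr (fun p hp => f p hp.1) ?_ ?_ ?_
  · rintro p ⟨hp, hd⟩
    exact ⟨hfT p hp, by rw [← hr _ _ (hf p hp), hd]⟩
  · intro p p' hp hp' h
    refine hinj _ _ _ (hf p hp.1) ?_
    rw [h]
    exact hf p' hp'.1
  · rintro q ⟨hq, hd⟩
    obtain ⟨p, hp, h⟩ := hTS q hq
    exact ⟨p, ⟨hp, by rw [hr _ _ h, hd]⟩, hfun _ _ _ (hf p hp) h⟩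

end PairSeries

/-! ### The telescoping bijection and the inverse series -/

section Telescope

variable {F : Set (FreeMonoid X)} {wt : X → ℕ}

/-- Pairs of a `(k - 1)`-chain with tail `t` and a normal word `s` such that `t * s` is normal. -/
def fusiblePairs (F : Set (FreeMonoid X)) (k : ℕ) : Set (FreeMonoid X × FreeMonoid X) :=
  {p | IsNormal F p.2 ∧ ∃ t, IsChain F k p.1 t ∧ IsNormal F (t * p.2)}

/-- Pairs of a `(k - 1)`-chain with tail `t` and a normal word `s` such that `t * s` is not
normal. -/
def infusiblePairs (F : Set (FreeMonoid X)) (k : ℕ) : Set (FreeMonoid X × FreeMonoid X) :=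
  {p | IsNormal F p.2 ∧ ∃ t, IsChain F k p.1 t ∧ ¬ IsNormal F (t * p.2)}

theorem disjoint_fusiblePairs (k : ℕ) : Disjoint (fusiblePairs F k) (infusiblePairs F k) := by
  rw [Set.disjoint_left]
  rintro p ⟨-, t, ht, h⟩ ⟨-, t', ht', h'⟩
  obtain rfl := (ht.eq_of_mul_eq_mul ht' (rfl : p.1 * 1 = p.1 * 1)).2
  exact h' h

theorem chain_prod_normal_eq_union (k : ℕ) :
    {c | ∃ t, IsChain F k c t} ×ˢ {m | IsNormal F m} = fusiblePairs F k ∪ infusiblePairs F k := by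
  ext p
  constructor
  · rintro ⟨⟨t, ht⟩, hp⟩
    by_cases h : IsNormal F (t * p.2)
    · exact Or.inl ⟨hp, t, ht, h⟩
    · exact Or.inr ⟨hp, t, ht, h⟩
  · rintro (⟨hp, t, ht, -⟩ | ⟨hp, t, ht, -⟩) <;> exact ⟨⟨t, ht⟩, hp⟩

/-- Cutting off the shortest prefix of `s` that makes `t` non-normal turns an infusible pair into a
fusible pair for chains of the next order. -/
theorem pairSeries_infusiblePairs (h1 : IsNormal F 1)
    (hanti : ∀ f ∈ F, ∀ f' ∈ F, IsSubword f f' → f = f') (k : ℕ) :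
    pairSeries wt (infusiblePairs F (k + 1)) = pairSeries wt (fusiblePairs F (k + 2)) := by
  refine pairSeries_congr (fun p q => ∃ t s, IsChain F (k + 1) p.1 t ∧
    IsMinimalNonnormal F (t * s) ∧ q.1 = p.1 * s ∧ p.2 = s * q.2) ?_ ?_ ?_ ?_ ?_
  · rintro ⟨c, s⟩ ⟨c', s'⟩ ⟨t, s₁, -, -, h, h'⟩
    dsimp only at h h' ⊢
    rw [h, h', weight_mul, weight_mul, add_assoc]
  · rintro ⟨c, s⟩ ⟨hs, t, ht, hn⟩
    obtain ⟨s₁, s₂, rfl, hmin⟩ := exists_split_of_not_isNormal_mul (ht.hasNormalPrefixes h1) hn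
    have hdeg := hmin.degF_eq_one hanti
    exact ⟨(c * s₁, s₂), ⟨hs.right, s₁, .extend ht hs.left hdeg.1 hdeg.2, hs⟩,
      t, s₁, ht, hmin, rfl, rfl⟩
  -- The inverse moves the last tail `t` back in front of `s`; fusibility is exactly what keeps `t *
  -- s` normal.
  · rintro ⟨c, s⟩ ⟨hs, t, ht, hn⟩
    obtain ⟨g, r, hg, ht', hmin, hc⟩ := ht.isMinimalNonnormal_of_extend
    refine ⟨(g, t * s), ⟨hn, r, hg, fun h => hmin.1 ?_⟩, r, t, hg, hmin, hc, rfl⟩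
    rw [← mul_assoc] at h
    exact h.left
  · rintro ⟨c, s⟩ ⟨c', s'⟩ ⟨q, q'⟩ ⟨t, u, ht, hmin, h, h'⟩ ⟨t', u', ht', hmin', h2, h2'⟩
    dsimp only at ht ht' h h' h2 h2'
    obtain ⟨rfl, rfl⟩ := ht.eq_of_mul_eq_mul ht' (h.symm.trans h2)
    obtain rfl := mul_left_cancel (h.symm.trans h2)
    rw [h', h2']
  · rintro ⟨c, s⟩ ⟨q, q'⟩ ⟨p, p'⟩ ⟨t, u, ht, hmin, h, h'⟩ ⟨t', u', ht', hmin', h2, h2'⟩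
    dsimp only at ht ht' h h' h2 h2'
    obtain rfl := (ht.eq_of_mul_eq_mul ht' (rfl : c * 1 = c * 1)).2
    have := hmin.eq_of_mul_eq_mul hmin' (b := q') (d := p')
      (by rw [mul_assoc, mul_assoc, ← h', h2'])
    obtain rfl := mul_left_cancel this
    rw [h, h2, mul_left_cancel (h'.symm.trans h2')]

theorem fusiblePairs_zero :
    fusiblePairs F 0 = {p | p.1 = 1 ∧ IsNormal F p.2} := by
  ext ⟨c, s⟩
  constructor
  · rintro ⟨hs, t, ht, -⟩
    cases ht
    exact ⟨rfl, hs⟩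
  · rintro ⟨h, hs⟩
    dsimp only at h hs
    subst h
    exact ⟨hs, 1, .empty, by simpa using hs⟩

theorem infusiblePairs_zero : infusiblePairs F 0 = ∅ := by
  refine Set.eq_empty_of_forall_notMem ?_
  rintro ⟨c, s⟩ ⟨hs, t, ht, h⟩
  cases ht
  exact h (by simpa using hs)

/-- The empty word contributes 1. A nonempty normal word splits as its first letter, a 0-chain that
is its own tail, and the rest. -/
theorem pairSeries_fusiblePairs_zero (h1 : IsNormal F 1)
    (hfin : ∀ d, {m | weight wt m = d}.Finite) :
    pairSeries wt (fusiblePairs F 0) = 1 + pairSeries wt (fusiblePairs F 1) := by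
  have hsplit : fusiblePairs F 0 =
      {(1, 1)} ∪ {p | (p.1 = 1 ∧ IsNormal F p.2) ∧ p.2 ≠ 1} := by
    ext ⟨c, s⟩
    simp only [fusiblePairs_zero, Set.mem_ofPred_eq, Set.mem_union, Set.mem_singleton_iff,
      Prod.mk.injEq]
    by_cases hs : s = 1
    · simp [hs, h1]
    · simp [hs]
  rw [hsplit, pairSeries_union hfin, pairSeries_singleton_one]
  · congr 1
    refine pairSeries_congr (fun p q => p.1 = 1 ∧ ∃ x, q.1 = FreeMonoid.of x ∧
      p.2 = FreeMonoid.of x * q.2) ?_ ?_ ?_ ?_ ?_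
    · rintro ⟨c, s⟩ ⟨c', s'⟩ ⟨h, x, h', h''⟩
      dsimp only at h h' h'' ⊢
      rw [h, h', h'', weight_mul, weight_one, zero_add]
    · rintro ⟨c, s⟩ ⟨⟨hc, hs⟩, hne⟩
      dsimp only at hc hs hne
      induction s using FreeMonoid.inductionOn' with
      | one => exact absurd rfl hne
      | of_mul x s _ =>
        exact ⟨(FreeMonoid.of x, s), ⟨hs.right, _, .letter x, hs⟩, hc, x, rfl, rfl⟩
    · rintro ⟨c, s⟩ ⟨hs, t, ht, h⟩
      dsimp only at hs ht h
      cases ht with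
      | letter x =>
        refine ⟨(1, FreeMonoid.of x * s), ⟨⟨rfl, h⟩, fun h => ?_⟩, rfl, x, rfl, rfl⟩
        have := congrArg FreeMonoid.length h
        rw [FreeMonoid.length_mul, FreeMonoid.length_of, FreeMonoid.length_one] at this
        omega
    · rintro ⟨c, s⟩ ⟨c', s'⟩ ⟨q, q'⟩ ⟨h, x, hx, h'⟩ ⟨h2, x', hx', h2'⟩
      dsimp only at h h' hx h2 h2' hx'
      rw [h, h2, h', h2', ← hx, ← hx']
    · rintro ⟨c, s⟩ ⟨q, q'⟩ ⟨p, p'⟩ ⟨h, x, hx, h'⟩ ⟨h2, x', hx', h2'⟩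
      dsimp only at h h' hx h2 h2' hx'
      have := List.cons.inj (congrArg FreeMonoid.toList (h'.symm.trans h2'))
      rw [hx, hx', this.1, show q' = p' from this.2]
  · rw [Set.disjoint_left]
    rintro p hp ⟨-, h⟩
    rw [Set.mem_singleton_iff] at hp
    exact h (by rw [hp])

theorem wordSeries_chain_mul_normal (hfin : ∀ d, {m | weight wt m = d}.Finite) (k : ℕ) :
    wordSeries wt {c | ∃ t, IsChain F k c t} * wordSeries wt {m | IsNormal F m} =
      pairSeries wt (fusiblePairs F k) + pairSeries wt (infusiblePairs F k) := by
  rw [wordSeries_mul_wordSeries hfin, chain_prod_normal_eq_union,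
    pairSeries_union hfin (disjoint_fusiblePairs k)]

/-- The partial alternating sums of the chain series invert the series of normal words, up to an
error term counting pairs that involve long chains. -/
theorem sum_range_mul_normal (h1 : IsNormal F 1)
    (hanti : ∀ f ∈ F, ∀ f' ∈ F, IsSubword f f' → f = f')
    (hfin : ∀ d, {m | weight wt m = d}.Finite) (n : ℕ) :
    (∑ k ∈ Finset.range (n + 1), (-1) ^ k * wordSeries wt {c | ∃ t, IsChain F k c t}) *
      wordSeries wt {m | IsNormal F m} =
        1 + (-1) ^ n * pairSeries wt (fusiblePairs F (n + 1)) := by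
  induction n with
  | zero =>
    have h0 : pairSeries wt (∅ : Set (FreeMonoid X × FreeMonoid X)) = 0 := by
      ext d
      simp [pairSeries]
    rw [Finset.sum_range_one, pow_zero, one_mul, one_mul, wordSeries_chain_mul_normal hfin,
      infusiblePairs_zero, h0, add_zero, pairSeries_fusiblePairs_zero h1 hfin]
  | succ n ih =>
    -- The new fusible term cancels the old error; the new infusible term becomes the next error.
    rw [Finset.sum_range_succ, add_mul, ih, mul_assoc, wordSeries_chain_mul_normal hfin,
      pairSeries_infusiblePairs h1 hanti]
    ring

theorem coeff_wordSeries_chain_eq_zero (hpos : ∀ x, 0 < wt x) {k d : ℕ} (h : d + 1 < k) :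
    PowerSeries.coeff d (wordSeries wt {c | ∃ t, IsChain F k c t}) = 0 := by
  rw [wordSeries, PowerSeries.coeff_mk, Nat.cast_eq_zero]
  convert Set.ncard_empty (FreeMonoid X)
  refine Set.eq_empty_of_forall_notMem ?_
  rintro c ⟨⟨t, ht⟩, hd⟩
  have := ht.le_length.1
  have := length_le_weight hpos c
  omega

theorem coeff_pairSeries_fusiblePairs_eq_zero (hpos : ∀ x, 0 < wt x) {k d : ℕ} (h : d + 1 < k) :
    PowerSeries.coeff d (pairSeries wt (fusiblePairs F k)) = 0 := by
  rw [pairSeries, PowerSeries.coeff_mk, Nat.cast_eq_zero]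
  convert Set.ncard_empty (FreeMonoid X × FreeMonoid X)
  refine Set.eq_empty_of_forall_notMem ?_
  rintro p ⟨⟨-, t, ht, -⟩, hd⟩
  have := ht.le_length.1
  have := length_le_weight hpos p.1
  omega

theorem exists_hasSum_chain (h1 : IsNormal F 1)
    (hanti : ∀ f ∈ F, ∀ f' ∈ F, IsSubword f f' → f = f') (hpos : ∀ x, 0 < wt x)
    (hfin : ∀ d, {m | weight wt m = d}.Finite) :
    ∃ S : PowerSeries ℤ,
      HasSum (fun k : ℕ => (-1) ^ k * wordSeries wt {c | ∃ t, IsChain F k c t}) S ∧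
      wordSeries wt {m | IsNormal F m} * S = 1 := by
  have hneg : ∀ (k d : ℕ) (f : PowerSeries ℤ), PowerSeries.coeff d f = 0 →
      PowerSeries.coeff d ((-1) ^ k * f) = 0 := by
    intro k d f hf
    rcases neg_one_pow_eq_or (PowerSeries ℤ) k with h | h <;> simp [h, hf]
  have hsum : Summable (fun k : ℕ => (-1 : PowerSeries ℤ) ^ k *
      wordSeries wt {c | ∃ t, IsChain F k c t}) := by
    rw [PowerSeries.WithPiTopology.summable_iff_summable_coeff]
    intro d
    refine summable_of_ne_finset_zero (s := Finset.range (d + 2)) fun k hk => ?_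
    rw [Finset.mem_range] at hk
    exact hneg _ _ _ (coeff_wordSeries_chain_eq_zero hpos (by omega))
  refine ⟨_, hsum.hasSum, ?_⟩
  have hlim := ((hsum.hasSum.tendsto_sum_nat.comp (Filter.tendsto_add_atTop_nat 1)).mul_const
    (wordSeries wt {m | IsNormal F m}))
  rw [mul_comm]
  refine tendsto_nhds_unique hlim ?_
  rw [PowerSeries.WithPiTopology.tendsto_iff_coeff_tendsto]
  intro d
  -- The error involves chains of index `n + 1`, which exceeds `d + 1` from here on, so their degree
  -- exceeds `d`.
  refine tendsto_atTop_of_eventually_const (i₀ := d + 1) fun n hn => ?_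
  rw [Function.comp_apply, sum_range_mul_normal h1 hanti hfin, map_add,
    hneg _ _ _ (coeff_pairSeries_fusiblePairs_eq_zero hpos (by omega)), add_zero]

end Telescope

/-! ### Normal words form a basis of the quotient -/

section Basis

variable {K : Type u} [Field K] {R : Set (FreeAlg K X)}

/-- The class of a word in `K⟨X | R⟩`. -/
noncomputable def wordClass (R : Set (FreeAlg K X)) (m : FreeMonoid X) : PresentedAlg R :=
  (TwoSidedIdeal.span R).ringCon.mkₐ (α := K) (wordElt K m)

theorem mkₐ_eq_zero_iff {f : FreeAlg K X} :
    (TwoSidedIdeal.span R).ringCon.mkₐ (α := K) f = 0 ↔ f ∈ TwoSidedIdeal.span R := by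
  rw [TwoSidedIdeal.mem_iff, ← RingCon.eq]
  rfl

theorem wordElt_mul (a b : FreeMonoid X) : wordElt K (a * b) = wordElt K a * wordElt K b := by
  simp [wordElt, MonoidAlgebra.single_mul_single]

theorem eq_sum_smul_wordElt (f : FreeAlg K X) :
    f = ∑ m ∈ f.coeff.support, f.coeff m • wordElt K m := by
  conv_lhs => rw [← MonoidAlgebra.sum_coeff_single f]
  simp [Finsupp.sum, wordElt]

theorem mkₐ_eq_sum (f : FreeAlg K X) :
    (TwoSidedIdeal.span R).ringCon.mkₐ (α := K) f =
      ∑ m ∈ f.coeff.support, f.coeff m • wordClass R m := by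
  conv_lhs => rw [eq_sum_smul_wordElt f]
  simp only [map_sum, map_smul, wordClass]

theorem linearIndependent_wordElt : LinearIndependent K (wordElt K : FreeMonoid X → FreeAlg K X) :=
  (MonoidAlgebra.basis (FreeMonoid X) K).linearIndependent

variable {lt : FreeMonoid X → FreeMonoid X → Prop}

theorem exists_isLeadingWord (hlt : IsAdmissible lt) {f : FreeAlg K X} (hf : f ≠ 0) :
    ∃ m, IsLeadingWord lt f m := by
  classical
  have := hlt.isWellOrder
  let := linearOrderOfSTO lt
  have hne : f.coeff.support.Nonempty := by
    rw [Finsupp.support_nonempty_iff]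
    simpa using hf
  refine ⟨f.coeff.support.max' hne, Finset.max'_mem _ hne, fun m hm hmne => ?_⟩
  exact lt_of_le_of_ne (Finset.le_max' _ m hm) hmne

variable {G : Set (FreeAlg K X)}

/-- Well-founded induction on the word: if it is `a * f * b` with `f` the leading word of `g`, then
`a * g * b` vanishes in the quotient and expresses it through smaller words. -/
theorem wordClass_mem_span_normal (hlt : IsAdmissible lt)
    (hG : IsGroebnerBasis lt (TwoSidedIdeal.span R) G) (m : FreeMonoid X) :
    wordClass R m ∈ Submodule.span K (wordClass R '' {m | IsNormal (leadingWords lt G) m}) := by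
  classical
  have := hlt.isWellOrder
  induction m using (IsWellFounded.wf (r := lt)).induction with
  | _ m ih =>
  by_cases hm : IsNormal (leadingWords lt G) m
  · exact Submodule.subset_span ⟨m, hm, rfl⟩
  simp only [IsNormal, not_forall, not_not] at hm
  obtain ⟨f, ⟨g, hgG, hgf⟩, a, b, rfl⟩ := hm
  have h0 : ∑ m ∈ g.coeff.support, g.coeff m • wordClass R (a * m * b) = 0 := by
    have h : (TwoSidedIdeal.span R).ringCon.mkₐ (α := K) (wordElt K a * g * wordElt K b) = 0 :=
      mkₐ_eq_zero_iff.2 (TwoSidedIdeal.mul_mem_right _ _ _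
        (TwoSidedIdeal.mul_mem_left _ _ _ (hG.subset g hgG)))
    rw [map_mul, map_mul, mkₐ_eq_sum g, Finset.mul_sum, Finset.sum_mul] at h
    rw [← h]
    refine Finset.sum_congr rfl fun m _ => ?_
    rw [wordClass, wordElt_mul, wordElt_mul, map_mul, map_mul, mul_smul_comm, smul_mul_assoc]
    rfl
  rw [← Finset.add_sum_erase _ _ hgf.1, add_eq_zero_iff_eq_neg] at h0
  have hc : g.coeff f ≠ 0 := Finsupp.mem_support_iff.1 hgf.1
  rw [← Submodule.smul_mem_iff _ hc, h0]
  refine Submodule.neg_mem _ (Submodule.sum_mem _ fun m hm => Submodule.smul_mem _ _ (ih _ ?_))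
  rw [Finset.mem_erase] at hm
  exact hlt.mul_right _ _ _ (hlt.mul_left _ _ _ (hgf.2 m hm.2 hm.1))

/-- A nontrivial relation would be a nonzero element of the ideal with only normal words, yet its
leading word contains an obstruction. -/
theorem linearIndepOn_wordClass_normal (hlt : IsAdmissible lt)
    (hG : IsGroebnerBasis lt (TwoSidedIdeal.span R) G) :
    LinearIndepOn K (wordClass R) {m | IsNormal (leadingWords lt G) m} := by
  rw [linearIndepOn_iff]
  intro l hl h0
  by_contra hne
  have hI : MonoidAlgebra.ofCoeff l ∈ TwoSidedIdeal.span R := by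
    rw [← mkₐ_eq_zero_iff, mkₐ_eq_sum]
    exact h0
  obtain ⟨m, hm⟩ := exists_isLeadingWord hlt (f := MonoidAlgebra.ofCoeff l) (by simpa using hne)
  obtain ⟨m', hm', hsub⟩ := hG.divides _ hI m hm
  exact hl hm.1 m' hm' hsub

/-- Otherwise the empty word is an obstruction and no word is normal, so the spanning set is empty
and `1 = 0` in the quotient. -/
theorem isNormal_one_of_nontrivial [Nontrivial (PresentedAlg R)] (hlt : IsAdmissible lt)
    (hG : IsGroebnerBasis lt (TwoSidedIdeal.span R) G) : IsNormal (leadingWords lt G) 1 := by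
  by_contra h
  have hempty : {m | IsNormal (leadingWords lt G) m} = ∅ := by
    refine Set.eq_empty_of_forall_notMem fun m hm => h ?_
    rintro f hf ⟨a, b, hab⟩
    have h2 := congrArg FreeMonoid.length hab
    rw [FreeMonoid.length_mul, FreeMonoid.length_mul, FreeMonoid.length_one] at h2
    obtain rfl : f = 1 := FreeMonoid.length_eq_zero.1 (by omega)
    exact hm 1 hf ⟨1, m, by simp⟩
  have hmem := wordClass_mem_span_normal (R := R) hlt hG 1
  rw [hempty, Set.image_empty, Submodule.span_empty, Submodule.mem_bot] at hmem
  refine one_ne_zero (α := PresentedAlg R) ?_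
  rw [← hmem, wordClass, show wordElt K (1 : FreeMonoid X) = 1 from rfl, map_one]

variable (wt : X → ℕ)

theorem wordClass_mem_algComponent (m : FreeMonoid X) :
    wordClass R m ∈ algComponent wt R (weight wt m) :=
  Submodule.mem_map_of_mem (Submodule.subset_span ⟨m, rfl, rfl⟩)

/-- The normal words of degree `d` span the degree `d` component of the quotient. -/
theorem algComponent_eq_span_normal [GradedAlgebra (algComponent wt R)] (hlt : IsAdmissible lt)
    (hG : IsGroebnerBasis lt (TwoSidedIdeal.span R) G) (d : ℕ) :
    algComponent wt R d = Submodule.span K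
      (wordClass R '' {m | IsNormal (leadingWords lt G) m ∧ weight wt m = d}) := by
  apply le_antisymm
  · rw [algComponent, freeComponent, Submodule.map_span, Submodule.span_le]
    rintro _ ⟨_, ⟨m, rfl, rfl⟩, rfl⟩
    have hmem := wordClass_mem_span_normal (R := R) hlt hG m
    -- Rewriting need not preserve degree when `R` is not homogeneous; projecting to the degree of
    -- `m` fixes the class of `m` and kills the normal words of other degrees.
    have hproj := Submodule.mem_map_of_mem
      (f := GradedAlgebra.proj (algComponent wt R) (weight wt m)) hmem
    rw [GradedAlgebra.proj_apply,
      DirectSum.decompose_of_mem_same _ (wordClass_mem_algComponent wt m)] at hproj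
    refine (Submodule.map_span_le _ _ _).2 ?_ hproj
    rintro _ ⟨n, hn, rfl⟩
    rw [GradedAlgebra.proj_apply]
    by_cases hnd : weight wt n = weight wt m
    · rw [← hnd, DirectSum.decompose_of_mem_same _ (wordClass_mem_algComponent wt n)]
      exact Submodule.subset_span ⟨n, ⟨hn, rfl⟩, rfl⟩
    · rw [DirectSum.decompose_of_mem_ne _ (wordClass_mem_algComponent wt n) hnd]
      exact Submodule.zero_mem _
  · rw [Submodule.span_le]
    rintro _ ⟨m, ⟨-, rfl⟩, rfl⟩
    exact wordClass_mem_algComponent wt m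

theorem finrank_span_image_eq_ncard {ι V : Type*} [AddCommGroup V] [Module K V] {v : ι → V}
    {s : Set ι} (hs : LinearIndepOn K v s) (hfin : s.Finite) :
    Module.finrank K (Submodule.span K (v '' s)) = s.ncard := by
  have := hfin.fintype
  have := finrank_span_eq_card hs
  rw [Set.range_comp', Subtype.range_coe] at this
  rw [this, Set.ncard_eq_toFinset_card', Set.toFinset_card]

/-- A span of words consists of the elements supported on those words, so intersecting two such
spans intersects the sets of words. -/
theorem chainComponent_eq_span (F : Set (FreeMonoid X)) (k d : ℕ) :
    chainComponent K wt F k d =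
      Submodule.span K (wordElt K '' {c | (∃ t, IsChain F k c t) ∧ weight wt c = d}) := by
  have h := fun s : Set (FreeMonoid X) => (MonoidAlgebra.supported_eq_span_single K s).symm
  change Submodule.span K ((fun m => MonoidAlgebra.single m 1) '' _) ⊓
    Submodule.span K ((fun m => MonoidAlgebra.single m 1) '' _) =
    Submodule.span K ((fun m => MonoidAlgebra.single m 1) '' _)
  rw [h, h, h]
  ext f
  simp only [Submodule.mem_inf, MonoidAlgebra.mem_supported, ← Set.subset_inter_iff]
  rfl

variable {wt} in
theorem hilbertSeries_algComponent [GradedAlgebra (algComponent wt R)] (hlt : IsAdmissible lt)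
    (hG : IsGroebnerBasis lt (TwoSidedIdeal.span R) G) (hfin : ∀ d, {m | weight wt m = d}.Finite) :
    hilbertSeries (algComponent wt R) =
      wordSeries wt {m | IsNormal (leadingWords lt G) m} := by
  ext d
  rw [hilbertSeries, wordSeries, PowerSeries.coeff_mk, PowerSeries.coeff_mk,
    algComponent_eq_span_normal wt hlt hG, finrank_span_image_eq_ncard]
  · rfl
  · exact (linearIndepOn_wordClass_normal hlt hG).mono fun _ h => h.1
  · exact (hfin d).subset fun _ h => h.2

variable {wt} in
theorem hilbertSeries_chainComponent (F : Set (FreeMonoid X))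
    (hfin : ∀ d, {m | weight wt m = d}.Finite) (k : ℕ) :
    hilbertSeries (chainComponent K wt F k) = wordSeries wt {c | ∃ t, IsChain F k c t} := by
  ext d
  rw [hilbertSeries, wordSeries, PowerSeries.coeff_mk, PowerSeries.coeff_mk,
    chainComponent_eq_span, finrank_span_image_eq_ncard]
  · rfl
  · exact linearIndependent_wordElt.linearIndepOn _
  · exact (hfin d).subset fun _ h => h.2

end Basis

/-- Minimality handles distinct basis elements; for a single one, the leading word is unique. -/
theorem IsReducedGroebnerBasis.antichain {K X : Type*} [Field K]
    {lt : FreeMonoid X → FreeMonoid X → Prop} (hlt : IsAdmissible lt)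
    {I : TwoSidedIdeal (FreeAlg K X)} {G : Set (FreeAlg K X)}
    (hG : IsReducedGroebnerBasis lt I G) :
    ∀ f ∈ leadingWords lt G, ∀ f' ∈ leadingWords lt G, IsSubword f f' → f = f' := by
  have := hlt.isWellOrder
  rintro f ⟨g, hg, hgf⟩ f' ⟨g', hg', hgf'⟩ hsub
  by_cases h : g = g'
  · subst h
    by_contra hne
    exact (Std.Asymm.asymm (r := lt) _ _ (hgf.2 _ hgf'.1 (Ne.symm hne))) (hgf'.2 _ hgf.1 hne)
  · exact absurd hsub (hG.minimal g hg g' hg' h f f' hgf hgf')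

end HilbertChains

theorem theorem7p4p2 {K : Type*} {X : Type*} [Field K]
    (wt : X → ℕ) (hwt_pos : ∀ x, 0 < wt x) (hwt_fin : ∀ d, {x | wt x = d}.Finite)
    (R : Set (HilbertChains.FreeAlg K X))
    [Nontrivial (HilbertChains.PresentedAlg R)]
    [GradedAlgebra (HilbertChains.algComponent wt R)]
    (lt : FreeMonoid X → FreeMonoid X → Prop) (hlt : HilbertChains.IsAdmissible lt)
    (G : Set (HilbertChains.FreeAlg K X))
    (hG : HilbertChains.IsReducedGroebnerBasis lt (TwoSidedIdeal.span R) G)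
    (F : Set (FreeMonoid X)) (hF : F = HilbertChains.leadingWords lt G) :
    (∀ d, Module.Finite K (HilbertChains.algComponent wt R d)) ∧
    (∀ k d, Module.Finite K (HilbertChains.chainComponent K wt F k d)) ∧
    HilbertChains.hilbertSeries (HilbertChains.chainComponent K wt F 0) = 1 ∧
    HilbertChains.hilbertSeries (HilbertChains.chainComponent K wt F 1) =
      HilbertChains.wordSeries wt (Set.range FreeMonoid.of) ∧
    HilbertChains.hilbertSeries (HilbertChains.chainComponent K wt F 2) =
      HilbertChains.wordSeries wt F ∧
    ∃ S : PowerSeries ℤ,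
      HasSum (fun k : ℕ =>
        (-1) ^ k * HilbertChains.hilbertSeries (HilbertChains.chainComponent K wt F k)) S ∧
      HilbertChains.hilbertSeries (HilbertChains.algComponent wt R) * S = 1 := by
  subst hF
  have hfin := HilbertChains.finite_setOf_weight_eq hwt_pos hwt_fin
  have hGB := hG.toIsGroebnerBasis
  have h1 := HilbertChains.isNormal_one_of_nontrivial hlt hGB
  have hanti := hG.antichain hlt
  simp only [HilbertChains.hilbertSeries_chainComponent _ hfin,
    HilbertChains.hilbertSeries_algComponent hlt hGB hfin]
  refine ⟨fun d => ?_, fun k d => ?_, ?_, ?_, ?_,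
    HilbertChains.exists_hasSum_chain h1 hanti hwt_pos hfin⟩
  · rw [HilbertChains.algComponent_eq_span_normal wt hlt hGB]
    exact Module.Finite.span_of_finite K (((hfin d).subset fun _ h => h.2).image _)
  · rw [HilbertChains.chainComponent_eq_span]
    exact Module.Finite.span_of_finite K (((hfin d).subset fun _ h => h.2).image _)
  · simp only [HilbertChains.isChain_zero_iff]
    ext d
    rw [HilbertChains.wordSeries, PowerSeries.coeff_mk, PowerSeries.coeff_one]
    split_ifs with hd
    · rw [Nat.cast_eq_one, Set.ncard_eq_one]
      refine ⟨1, ?_⟩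
      ext m
      simp only [Set.mem_ofPred_eq, Set.mem_singleton_iff, and_iff_left_iff_imp]
      rintro rfl
      exact (HilbertChains.weight_one wt).trans hd.symm
    · rw [Nat.cast_eq_zero]
      convert Set.ncard_empty (FreeMonoid X)
      refine Set.eq_empty_of_forall_notMem ?_
      rintro m ⟨rfl, h⟩
      exact hd ((HilbertChains.weight_one wt).symm.trans h).symm
  · simp only [HilbertChains.isChain_one_iff]
    rfl
  · simp only [HilbertChains.isChain_two_iff h1 hanti]
    rfl
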